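/- Conventions. All vector lattices are real and Archimedean, and linear topologies are Hausdorff. A locally solid topology on a vector lattice $E$ is a linear topology for which $0$ has a neighbourhood basis of solid sets. A net $(x_\alpha)_{\alpha\in A}$ in $E$ is order convergent to $x$ if there is a net $(y_\beta)_{\beta\in B}$ in $E$ with $y_\beta\downarrow 0$ such that for every $\beta_0\in B$ there is $\alpha_0\in A$ with $|x_\alpha-x|\le y_{\beta_0}$ for all $\alpha\ge\alpha_0$; it is uo-convergent to $x$ if $|x_\alpha-x|\wedge|y|$ is order convergent to $0$ for every $y\in E$. A uo-Lebesgue topology on $E$ is a locally solid topology $\tau$ such that every net that is uo-convergent to some $x\in E$ is also $\tau$-convergent to $x$. The carrier of $\tau$ is $C_\tau=\bigcup N^{\mathrm d}$, where $N$ runs over all intersections $\bigcap_{n\ge1}V_n$ of sequences $(V_n)_{n\ge 1}$ of solid $\tau$-neighbourhoods of $0$ with $V_{n+1}+V_{n+1}\subseteq V_n$ for all $n$, and $N^{\mathrm d}$ is the disjoint complement of $N$. $E$ has the countable sup property if every subset of $E$ that has a supremum contains an at most countable subset with the same supremum. An order basis of $C_\tau$ is a non-empty subset of $C_\tau$ whose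 disjoint complement in $C_\tau$ is $\{0\}$. A sequence $(x_{\alpha_n})_{n\ge1}$ is embedded in a net $(x_\alpha)_{\alpha\in A}$ if $\alpha_1\le\alpha_2\le\cdots$, with $\alpha_1<\alpha_2<\cdots$ when $A$ has no largest element. Theorem. Let $\tau$ be a uo-Lebesgue topology on a vector lattice $E$. Then $C_\tau=E$ if and only if $E$ has the countable sup property; moreover, $C_\tau=E$ whenever $C_\tau$ has an at most countable order basis, and whenever $\tau$ is metrisable. If $C_\tau=E$, then: (1) every net in $E$ that is $\tau$-convergent to some $x\in E$ has an embedded sequence that is uo-convergent as well as $\tau$-convergent to $x$; (2) a sequence in $E$ is $\tau$-convergent to $x\in E$ if and only if every subsequence has a further subsequence that is uo-convergent to $x$. -/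

import Mathlib

open Set Filter Topology

namespace VectorLattice

universe u v

section Order

variable (E : Type u) [AddCommGroup E] [Lattice E]

/-- The vector lattice `E` is Archimedean: if the positive multiples `n • x` of a positive
element `x` are bounded from above, then `x = 0`. -/
def IsArchimedean : Prop :=
  ∀ x y : E, 0 ≤ x → (∀ n : ℕ, n • x ≤ y) → x = 0

/-- Every subset with a supremum contains an at most countable subset with the same supremum. -/
def CountableSupProperty : Prop :=
  ∀ (S : Set E) (x : E), IsLUB S x → ∃ T : Set E, T ⊆ S ∧ T.Countable ∧ IsLUB T x

variable {E}

/-- The disjoint complement `Sᵈ` of a subset `S` of a vector lattice. -/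
def disjointComplement (S : Set E) : Set E :=
  {x | ∀ y ∈ S, |x| ⊓ |y| = 0}

/-- `S` is an order basis of the vector sublattice `F` of `E`: it is a non-empty subset of `F`, and
its disjoint complement in `F` is zero. -/
def IsOrderBasis (F S : Set E) : Prop :=
  S.Nonempty ∧ S ⊆ F ∧ F ∩ disjointComplement S = {0}

/-- Order convergence of the net `x` to `a`. The dominating net `y` decreasing to zero may have a
directed index set `B` that is different from the index set `A` of `x`. (Only the set of values of
`y` matters, so that index sets in the universe of `E` suffice.) -/
def OrderConverges {A : Type v} [Preorder A] (x : A → E) (a : E) : Prop :=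
  ∃ (B : Type u) (_ : Preorder B) (_ : IsDirectedOrder B) (_ : Nonempty B) (y : B → E),
    Antitone y ∧ IsGLB (range y) 0 ∧
      ∀ β₀ : B, ∃ α₀ : A, ∀ α : A, α₀ ≤ α → |x α - a| ≤ y β₀

/-- Unbounded order convergence (uo-convergence) of the net `x` to `a`. -/
def UOConverges {A : Type v} [Preorder A] (x : A → E) (a : E) : Prop :=
  ∀ y : E, OrderConverges (fun α => |x α - a| ⊓ |y|) 0

end Order

/-- The indices `α 0 ≤ α 1 ≤ α 2 ≤ ⋯` of an embedded sequence in a net with index set `A`: they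
are increasing, and strictly increasing when `A` has no largest element. -/
def IsEmbeddedSequence {A : Type v} [Preorder A] (α : ℕ → A) : Prop :=
  Monotone α ∧ ((¬ ∃ a : A, IsTop a) → StrictMono α)

section Topology

variable (E : Type u) [AddCommGroup E] [Lattice E] [Module ℝ E] [TopologicalSpace E]

/-- A locally solid topology: a (Hausdorff) linear topology such that zero has a neighbourhood
basis consisting of solid sets. -/
structure IsLocallySolidTopology : Prop where
  isTopologicalAddGroup : IsTopologicalAddGroup E
  continuousSMul : ContinuousSMul ℝ E
  t2Space : T2Space E
  exists_solid : ∀ U ∈ 𝓝 (0 : E), ∃ V ∈ 𝓝 (0 : E), LatticeOrderedAddCommGroup.IsSolid V ∧ V ⊆ U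

/-- A uo-Lebesgue topology: a locally solid topology such that every uo-convergent net converges
topologically to the same limit. (Convergence of a net depends only on the filter of its tails in
`E`, so that nets with an index set in the universe of `E` suffice.) -/
structure IsUOLebesgueTopology : Prop extends IsLocallySolidTopology E where
  tendsto_of_uoConverges : ∀ (A : Type u) [Preorder A] [IsDirectedOrder A] [Nonempty A]
    (x : A → E) (a : E), UOConverges x a → Tendsto x atTop (𝓝 a)

variable {E} in
/-- A normal sequence of solid neighbourhoods of zero. -/
structure IsNormalSequence (V : ℕ → Set E) : Prop where
  mem_nhds : ∀ n, V n ∈ 𝓝 (0 : E)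
  solid : ∀ n, LatticeOrderedAddCommGroup.IsSolid (V n)
  add_mem : ∀ n, ∀ x ∈ V (n + 1), ∀ y ∈ V (n + 1), x + y ∈ V n

/-- The carrier `C_τ` of the topology `τ` on `E`: the union of the disjoint complements `Nᵈ`, where
`N` runs over the intersections of the normal sequences of solid neighbourhoods of zero. -/
def carrier : Set E :=
  {x | ∃ V : ℕ → Set E, IsNormalSequence V ∧ x ∈ disjointComplement (⋂ n, V n)}

end Topology

end VectorLattice

namespace VectorLattice

universe u v

/-! ### Vector lattices: order convergence, disjointness, Archimedean arguments. -/

section Order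

variable {E : Type u} [AddCommGroup E] [Lattice E]

/-! The core is the case `C_τ = E`. Write `u n` for the differences from the limit. Each `u k` is
disjoint from some `N_k = ⋂ n, V k n`, and since the net converges, the indices can be chosen
recursively so that `u n ∈ V k n` for all `k < n`. Such a sequence uo-converges to `0`
(`uoConverges_zero_of_mem`). Let `w ≥ 0` lie below all eventual upper bounds of `|u n| ⊓ |y|`. By
the Archimedean property `w` is the supremum of every tail of `w ⊓ |u n|`, hence the `τ`-limit of
its truncations by tail sums. These sums are small in every `V k`, so `w ∈ N_k` for all `k`. Then
`w` is disjoint from every `u k`, so `w = 0`. Applied to the net of finite suprema of a set, this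
gives the countable sup property. For the other implications, `C_τ` is order dense
(`exists_mem_carrier_le`), and countably many of its elements lie in a single `Nᵈ`. A countable
supremum of positive elements of `C_τ` therefore stays in `C_τ`, and a countable order basis forces
`N = {0}`. -/

lemma disjointComplement_anti {S T : Set E} (h : S ⊆ T) :
    disjointComplement T ⊆ disjointComplement S := fun _ hx y hy => hx y (h hy)

lemma orderConverges_zero_of_isGLB {A : Type v} [Preorder A] [IsDirectedOrder A] [Nonempty A]
    {x : A → E}
    (h : IsGLB {z : E | ∃ α₀ : A, ∀ α, α₀ ≤ α → |x α| ≤ z} 0) : OrderConverges x 0 := by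
  set S : Set E := {z : E | ∃ α₀ : A, ∀ α, α₀ ≤ α → |x α| ≤ z} with hS
  have hinf : ∀ a ∈ S, ∀ b ∈ S, a ⊓ b ∈ S := by
    rintro a ⟨α, hα⟩ b ⟨β, hβ⟩
    obtain ⟨γ, h1, h2⟩ := exists_ge_ge α β
    exact ⟨γ, fun δ hδ => le_inf (hα δ (h1.trans hδ)) (hβ δ (h2.trans hδ))⟩
  have hne : S.Nonempty := by
    by_contra hne
    rw [not_nonempty_iff_eq_empty] at hne
    rw [hne] at h
    have h0 : ∀ z : E, z ≤ 0 := fun z => h.2 (by simp)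
    have : (0 : E) ∈ S := ⟨Classical.arbitrary A, fun α _ => h0 _⟩
    simp [hne] at this
  refine ⟨Sᵒᵈ, inferInstance, ⟨fun a b => ?_⟩, hne.to_subtype, fun b => (OrderDual.ofDual b).1,
    fun a b hab => hab, ?_, fun b => ?_⟩
  · exact ⟨OrderDual.toDual ⟨_, hinf _ (OrderDual.ofDual a).2 _ (OrderDual.ofDual b).2⟩,
      (inf_le_left : (OrderDual.ofDual a).1 ⊓ (OrderDual.ofDual b).1 ≤ _),
      (inf_le_right : (OrderDual.ofDual a).1 ⊓ (OrderDual.ofDual b).1 ≤ _)⟩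
  · have : range (fun b : Sᵒᵈ => (OrderDual.ofDual b).1) = S := Subtype.range_coe
    rw [this]
    exact h
  · obtain ⟨α, hα⟩ := (OrderDual.ofDual b).2
    exact ⟨α, fun β hβ => by simpa using hα β hβ⟩

/-- The uo-Lebesgue property only tests nets indexed in the universe of `E`, so sequences have to be
lifted there. -/
lemma UOConverges.comp_uLift_down {x : ℕ → E} {a : E} (hx : UOConverges x a) :
    UOConverges (fun n : ULift.{u} ℕ => x n.down) a := by
  intro y
  obtain ⟨B, i1, i2, i3, z, hz, h0, h⟩ := hx y
  refine ⟨B, i1, i2, i3, z, hz, h0, fun β => ?_⟩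
  obtain ⟨n, hn⟩ := h β
  exact ⟨⟨n⟩, fun m hm => hn m.down hm⟩

lemma uoConverges_sub_right_iff {A : Type v} [Preorder A] {x : A → E} {a : E} :
    UOConverges (fun α => x α - a) 0 ↔ UOConverges x a := by
  simp only [UOConverges, sub_zero]

variable [IsOrderedAddMonoid E]

lemma add_inf_le_inf_add_inf {a b c : E} (ha : 0 ≤ a) (hb : 0 ≤ b) (hc : 0 ≤ c) :
    (a + b) ⊓ c ≤ a ⊓ c + b ⊓ c := by
  rw [add_inf, inf_add, inf_add]
  refine le_inf (le_inf inf_le_left ?_) (le_inf ?_ ?_)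
  · exact inf_le_right.trans (le_add_of_nonneg_right hb)
  · exact inf_le_right.trans (le_add_of_nonneg_left ha)
  · exact inf_le_right.trans (le_add_of_nonneg_right hc)

lemma inf_le_inf_add_sub {a b : E} (h : b ≤ a) (c : E) : a ⊓ c ≤ b ⊓ c + (a - b) := by
  rw [inf_add]
  refine le_inf ?_ ?_
  · simp
  · exact inf_le_right.trans (le_add_of_nonneg_right (sub_nonneg.2 h))

/-- In an Archimedean vector lattice, a bounded non-empty set is invariant under no translation by
a non-zero positive element. -/
lemma IsArchimedean.eq_zero_of_add_mem (hE : IsArchimedean E) {S : Set E} (hne : S.Nonempty)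
    (hS : BddAbove S) {t : E} (ht : 0 ≤ t) (h : ∀ s ∈ S, s + t ∈ S) : t = 0 := by
  obtain ⟨s, hs⟩ := hne
  obtain ⟨b, hb⟩ := hS
  have key : ∀ n : ℕ, s + n • t ∈ S := by
    intro n
    induction n with
    | zero => simpa using hs
    | succ n ih => rw [succ_nsmul, ← add_assoc]; exact h _ ih
  exact hE t (b - s) ht fun n => by
    rw [le_sub_iff_add_le']; exact hb (key n)

lemma mem_disjointComplement_of_abs_le {S : Set E} {x y : E} (hx : x ∈ disjointComplement S)
    (h : |y| ≤ |x|) : y ∈ disjointComplement S := fun z hz =>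
  le_antisymm ((inf_le_inf_right _ h).trans (hx z hz).le) (le_inf (abs_nonneg _) (abs_nonneg _))

lemma add_mem_disjointComplement {S : Set E} {x y : E} (hx0 : 0 ≤ x) (hy0 : 0 ≤ y)
    (hx : x ∈ disjointComplement S) (hy : y ∈ disjointComplement S) :
    x + y ∈ disjointComplement S := fun z hz => by
  have h := add_inf_le_inf_add_inf hx0 hy0 (abs_nonneg z)
  have h1 := hx z hz
  have h2 := hy z hz
  rw [abs_of_nonneg hx0] at h1
  rw [abs_of_nonneg hy0] at h2
  rw [h1, h2, add_zero] at h
  rw [abs_of_nonneg (add_nonneg hx0 hy0)]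
  exact le_antisymm h (le_inf (add_nonneg hx0 hy0) (abs_nonneg _))

/-- A disjoint complement contains the suprema of its sets of positive elements. -/
lemma isLUB_mem_disjointComplement {S T : Set E} {x : E} (hx : IsLUB T x) (hx0 : 0 ≤ x)
    (hT0 : ∀ z ∈ T, 0 ≤ z) (hT : T ⊆ disjointComplement S) : x ∈ disjointComplement S := by
  intro y hy
  rw [abs_of_nonneg hx0]
  have hw0 : 0 ≤ x ⊓ |y| := le_inf hx0 (abs_nonneg _)
  refine le_antisymm ?_ hw0
  -- Each `z ∈ T` is disjoint from `x ⊓ |y|`, so their sum is their supremum and still lies below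
  -- `x`.
  have hle : x ≤ x - x ⊓ |y| := by
    refine hx.2 fun z hz => ?_
    have h1 : z ⊓ (x ⊓ |y|) = 0 := by
      have h2 := hT hz y hy
      rw [abs_of_nonneg (hT0 z hz)] at h2
      exact le_antisymm ((inf_le_inf_left _ inf_le_right).trans h2.le) (le_inf (hT0 z hz) hw0)
    have h2 := inf_add_sup z (x ⊓ |y|)
    rw [h1, zero_add] at h2
    rw [le_sub_iff_add_le, ← h2]
    exact sup_le (hx.1 hz) inf_le_left
  exact sub_nonneg.1 (by simpa using sub_nonneg.2 hle)

lemma UOConverges.of_monotone {A : Type u} [Preorder A] [IsDirectedOrder A] [Nonempty A]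
    {x : A → E} {a : E} (hx : Monotone x) (ha : IsLUB (range x) a) : UOConverges x a := by
  intro y
  refine ⟨A, inferInstance, inferInstance, inferInstance, fun β => a - x β,
    fun α β h => sub_le_sub_left (hx h) a, ⟨?_, fun z hz => ?_⟩, fun β => ⟨β, fun α hα => ?_⟩⟩
  · rintro _ ⟨β, rfl⟩
    exact sub_nonneg.2 (ha.1 (mem_range_self β))
  · have : a ≤ a - z := ha.2 (by
      rintro _ ⟨β, rfl⟩
      rw [le_sub_comm]
      exact hz (mem_range_self β))
    simpa using this
  · have h1 : x α ≤ a := ha.1 (mem_range_self α)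
    rw [sub_zero, abs_of_nonneg (le_inf (abs_nonneg _) (abs_nonneg _)), abs_sub_comm,
      abs_of_nonneg (sub_nonneg.2 h1)]
    exact inf_le_left.trans (sub_le_sub_left (hx hα) a)

/-- If `w` lies below all the eventual upper bounds of the sequence `|x n| ⊓ y`, then every tail of
the sequence `w ⊓ |x n|` has `w` as its supremum. -/
lemma IsArchimedean.le_of_inf_abs_le (hE : IsArchimedean E) {x : ℕ → E} {y w : E}
    (hw : w ∈ lowerBounds {z : E | ∃ n₀ : ℕ, ∀ n, n₀ ≤ n → |x n| ⊓ y ≤ z})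
    {m : ℕ} {t : E} (ht : ∀ n, m ≤ n → w ⊓ |x n| ≤ t) : w ≤ t := by
  set S := {z : E | ∃ n₀ : ℕ, ∀ n, n₀ ≤ n → |x n| ⊓ y ≤ z}
  have hyS : y ∈ S := ⟨0, fun n _ => inf_le_right⟩
  have hr : w - w ⊓ t = 0 := by
    -- Lowering an eventual upper bound by `w - w ⊓ t` gives another one; negating `S` turns this
    -- into an upward shift.
    refine hE.eq_zero_of_add_mem (S := -S) ⟨-y, by simpa using hyS⟩ ⟨-w, fun s hs => ?_⟩
      (sub_nonneg.2 inf_le_left) fun s hs => ?_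
    · exact le_neg_of_le_neg (hw hs)
    · obtain ⟨n₀, hn₀⟩ := hs
      refine ⟨max n₀ m, fun n hn => ?_⟩
      have h1 : w ≤ -s ⊓ y := le_inf (hw ⟨n₀, hn₀⟩) (hw hyS)
      have h2 : |x n| ⊓ y ≤ (-s ⊓ y) ⊓ |x n| :=
        le_inf (le_inf (hn₀ n (le_of_max_le_left hn)) inf_le_right) inf_le_left
      have h3 := h2.trans (inf_le_inf_add_sub h1 |x n|)
      have h4 : w ⊓ |x n| ≤ w ⊓ t := le_inf inf_le_left (ht n (le_of_max_le_right hn))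
      calc |x n| ⊓ y ≤ w ⊓ t + (-s - w) := h3.trans (add_le_add h4 (sub_le_sub_right inf_le_left w))
        _ = -(s + (w - w ⊓ t)) := by abel
  rw [sub_eq_zero] at hr
  exact hr.le.trans inf_le_right

end Order

lemma exists_gt_of_not_exists_isTop {A : Type v} [Preorder A] [IsDirectedOrder A]
    (h : ¬ ∃ a : A, IsTop a) (a : A) : ∃ b, a < b := by
  have ha : ¬ IsTop a := fun ha => h ⟨a, ha⟩
  simp only [IsTop, not_forall] at ha
  obtain ⟨b, hb⟩ := ha
  obtain ⟨c, hac, hbc⟩ := exists_ge_ge a b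
  exact ⟨c, lt_of_le_not_ge hac fun hca => hb (hbc.trans hca)⟩

/-! ### Normal sequences and the carrier of a locally solid topology. -/

section Topology

variable {E : Type u} [AddCommGroup E] [Lattice E] [TopologicalSpace E]

namespace IsNormalSequence

variable {V : ℕ → Set E}

lemma zero_mem (hV : IsNormalSequence V) (n : ℕ) : (0 : E) ∈ V n := mem_of_mem_nhds (hV.mem_nhds n)

lemma antitone (hV : IsNormalSequence V) : Antitone V :=
  antitone_nat_of_succ_le fun n x hx => by
    simpa using hV.add_mem n x hx 0 (hV.zero_mem (n + 1))

lemma neg_mem (hV : IsNormalSequence V) {n : ℕ} {x : E} (hx : x ∈ V n) : -x ∈ V n :=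
  hV.solid n hx (abs_neg x).le

/-- Halving absorbs a whole tail: the first term is in `V (m + 1)`, and by induction so is the rest.
-/
lemma sum_mem (hV : IsNormalSequence V) {z : ℕ → E} (p m : ℕ) (hz : ∀ n, m < n → z n ∈ V n) :
    ∑ i ∈ Finset.range p, z (m + 1 + i) ∈ V m := by
  induction p generalizing m with
  | zero => simpa using hV.zero_mem m
  | succ p ih =>
    rw [Finset.sum_range_succ', add_comm]
    refine hV.add_mem m _ (by simpa using hz (m + 1) (by omega)) _ ?_
    have := ih (m + 1) fun n hn => hz n (by omega)
    simpa only [add_assoc, add_comm, add_left_comm] using this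

lemma closure_subset [IsTopologicalAddGroup E] (hV : IsNormalSequence V) (n : ℕ) :
    closure (V (n + 1)) ⊆ V n := by
  intro w hw
  have h1 : (fun y => y - w) ⁻¹' V (n + 1) ∈ 𝓝 w :=
    (continuous_id.sub continuous_const).continuousAt.preimage_mem_nhds
      (by simpa using hV.mem_nhds (n + 1))
  obtain ⟨y, hy1, hy2⟩ := mem_closure_iff_nhds.1 hw _ h1
  simpa using hV.add_mem n y hy2 _ (hV.neg_mem hy1)

lemma isClosed_iInter [IsTopologicalAddGroup E] (hV : IsNormalSequence V) :
    IsClosed (⋂ n, V n) :=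
  isClosed_of_closure_subset fun _ hw =>
    mem_iInter.2 fun n => hV.closure_subset n (closure_mono (iInter_subset V (n + 1)) hw)

lemma iInter_solid (hV : IsNormalSequence V) :
    LatticeOrderedAddCommGroup.IsSolid (⋂ n, V n) := fun _ hx _ hy =>
  mem_iInter.2 fun n => hV.solid n (mem_iInter.1 hx n) hy

lemma add_mem_iInter (hV : IsNormalSequence V) {x y : E} (hx : x ∈ ⋂ n, V n)
    (hy : y ∈ ⋂ n, V n) : x + y ∈ ⋂ n, V n :=
  mem_iInter.2 fun n => hV.add_mem n x (mem_iInter.1 hx _) y (mem_iInter.1 hy _)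

end IsNormalSequence

lemma carrier_eq_univ_of_iInter_subset {V : ℕ → Set E} (hV : IsNormalSequence V)
    [IsOrderedAddMonoid E] (h : ⋂ n, V n ⊆ {0}) : carrier E = univ :=
  eq_univ_of_forall fun x => ⟨V, hV, fun y hy => by
    rw [h hy, abs_zero]; exact inf_eq_right.2 (abs_nonneg x)⟩

variable [Module ℝ E]

namespace IsLocallySolidTopology

lemma exists_isNormalSequence (hτ : IsLocallySolidTopology E) {U : ℕ → Set E}
    (hU : ∀ n, U n ∈ 𝓝 (0 : E)) : ∃ V : ℕ → Set E, IsNormalSequence V ∧ ∀ n, V n ⊆ U n := by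
  have := hτ.isTopologicalAddGroup
  have step : ∀ (n : ℕ) (W : {W : Set E // W ∈ 𝓝 (0 : E)}), ∃ W' : {W : Set E // W ∈ 𝓝 (0 : E)},
      LatticeOrderedAddCommGroup.IsSolid W'.1 ∧ W'.1 ⊆ U n ∧
        ∀ x ∈ W'.1, ∀ y ∈ W'.1, x + y ∈ W.1 := by
    rintro n ⟨W, hW⟩
    obtain ⟨W₁, hW₁, hadd⟩ := exists_nhds_zero_half hW
    obtain ⟨W₂, hW₂, hs, hsub⟩ := hτ.exists_solid _ (inter_mem hW₁ (hU n))
    exact ⟨⟨W₂, hW₂⟩, hs, hsub.trans inter_subset_right,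
      fun x hx y hy => hadd x (hsub hx).1 y (hsub hy).1⟩
  choose f hs hf hadd using step
  let V : ℕ → {W : Set E // W ∈ 𝓝 (0 : E)} := fun n =>
    Nat.rec (f 0 ⟨univ, univ_mem⟩) (fun n W => f (n + 1) W) n
  refine ⟨fun n => (V n).1, ⟨fun n => (V n).2, fun n => ?_, fun n => hadd (n + 1) (V n)⟩,
    fun n => ?_⟩
  · cases n with
    | zero => exact hs _ _
    | succ n => exact hs _ _
  · cases n with
    | zero => exact hf _ _
    | succ n => exact hf _ _

/-- Countably many normal sequences are refined by a single one. -/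
lemma exists_isNormalSequence_iInter_subset (hτ : IsLocallySolidTopology E)
    {V : ℕ → ℕ → Set E} (hV : ∀ k, IsNormalSequence (V k)) :
    ∃ W : ℕ → Set E, IsNormalSequence W ∧ ∀ k, ⋂ n, W n ⊆ ⋂ n, V k n := by
  -- Diagonal choice: only the finitely many `k ≤ n` constrain the `n`-th neighbourhood.
  obtain ⟨W, hW, hWV⟩ := hτ.exists_isNormalSequence (U := fun n => ⋂ k ∈ Iic n, V k n)
    fun n => (biInter_mem (finite_Iic n)).2 fun k _ => (hV k).mem_nhds n
  refine ⟨W, hW, fun k y hy => mem_iInter.2 fun n => ?_⟩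
  have h1 := mem_iInter₂.1 (hWV (max k n) (mem_iInter.1 hy _)) k (le_max_left k n)
  exact (hV k).antitone (le_max_right k n) h1

/-- Every countable subset of the carrier lies in a single `Nᵈ`. -/
lemma exists_subset_disjointComplement (hτ : IsLocallySolidTopology E) [IsOrderedAddMonoid E]
    {T : Set E} (hT : T.Countable) (hTC : T ⊆ carrier E) :
    ∃ W : ℕ → Set E, IsNormalSequence W ∧ T ⊆ disjointComplement (⋂ n, W n) := by
  rcases T.eq_empty_or_nonempty with rfl | hne
  · obtain ⟨W, hW, -⟩ := hτ.exists_isNormalSequence (U := fun _ => univ) fun _ => univ_mem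
    exact ⟨W, hW, empty_subset _⟩
  · obtain ⟨f, rfl⟩ := hT.exists_eq_range hne
    choose V hV hfV using fun k => hTC (mem_range_self (f := f) k)
    obtain ⟨W, hW, hWV⟩ := hτ.exists_isNormalSequence_iInter_subset hV
    refine ⟨W, hW, ?_⟩
    rintro _ ⟨k, rfl⟩
    exact disjointComplement_anti (hWV k) (hfV k)

end IsLocallySolidTopology

lemma IsLocallySolidTopology.carrier_eq_univ_of_metrizableSpace [IsOrderedAddMonoid E]
    (hτ : IsLocallySolidTopology E) [TopologicalSpace.MetrizableSpace E] : carrier E = univ := by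
  obtain ⟨U, hU⟩ := (𝓝 (0 : E)).exists_antitone_basis
  obtain ⟨V, hV, hVU⟩ := hτ.exists_isNormalSequence (U := U) fun n => hU.mem n
  refine carrier_eq_univ_of_iInter_subset hV fun y hy => ?_
  by_contra hy0
  have h1 : ({y}ᶜ : Set E) ∈ 𝓝 (0 : E) := isOpen_compl_singleton.mem_nhds (Ne.symm hy0)
  obtain ⟨n, hn⟩ := hU.mem_iff.1 h1
  exact hn (hVU n (mem_iInter.1 hy n)) rfl

/-! ### Consequences of the uo-Lebesgue property. -/

namespace IsUOLebesgueTopology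

lemma tendsto_of_uoConverges_nat (hτ : IsUOLebesgueTopology E) {x : ℕ → E} {a : E}
    (hx : UOConverges x a) : Tendsto x atTop (𝓝 a) := by
  have h := hτ.tendsto_of_uoConverges (ULift.{u} ℕ) _ a hx.comp_uLift_down
  refine h.comp (g := fun n : ULift.{u} ℕ => x n.down) (f := ULift.up) ?_
  exact tendsto_atTop_atTop.2 fun b => ⟨b.down, fun n hn => hn⟩

variable [IsOrderedAddMonoid E]

lemma tendsto_of_monotone (hτ : IsUOLebesgueTopology E) {A : Type u} [Preorder A]
    [IsDirectedOrder A] [Nonempty A] {x : A → E} {a : E} (hx : Monotone x)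
    (ha : IsLUB (range x) a) : Tendsto x atTop (𝓝 a) :=
  hτ.tendsto_of_uoConverges A x a (.of_monotone hx ha)

lemma tendsto_of_monotone_nat (hτ : IsUOLebesgueTopology E) {x : ℕ → E} {a : E} (hx : Monotone x)
    (ha : IsLUB (range x) a) : Tendsto x atTop (𝓝 a) := by
  have h := hτ.tendsto_of_monotone (A := ULift.{u} ℕ) (x := fun n => x n.down)
    (fun m n h => hx h) (by
      have : range (fun n : ULift.{u} ℕ => x n.down) = range x :=
        ULift.down_surjective.range_comp x
      rwa [this])
  refine h.comp (g := fun n : ULift.{u} ℕ => x n.down) (f := ULift.up) ?_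
  exact tendsto_atTop_atTop.2 fun b => ⟨b.down, fun n hn => hn⟩

/-- The supremum of a non-empty upward directed set is in its closure. -/
lemma mem_closure_of_isLUB (hτ : IsUOLebesgueTopology E) {S : Set E} {a : E} (hne : S.Nonempty)
    (hsup : ∀ s ∈ S, ∀ t ∈ S, s ⊔ t ∈ S) (ha : IsLUB S a) : a ∈ closure S := by
  have : Nonempty S := hne.to_subtype
  have : IsDirectedOrder S := ⟨fun s t => ⟨⟨_, hsup s s.2 t t.2⟩,
    (le_sup_left : s.1 ≤ s.1 ⊔ t.1), (le_sup_right : t.1 ≤ s.1 ⊔ t.1)⟩⟩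
  have h := hτ.tendsto_of_monotone (x := ((↑) : S → E)) (fun _ _ h => h) (by simpa using ha)
  exact mem_closure_of_tendsto h (Eventually.of_forall fun s => s.2)

/-- The carrier is order dense. -/
lemma exists_mem_carrier_le (hE : IsArchimedean E) (hτ : IsUOLebesgueTopology E) {w : E}
    (hw : 0 ≤ w) (hw0 : w ≠ 0) : ∃ z ∈ carrier E, 0 ≤ z ∧ z ≤ w ∧ z ≠ 0 := by
  have := hτ.isTopologicalAddGroup
  have := hτ.t2Space
  obtain ⟨V, hV, hVU⟩ := hτ.exists_isNormalSequence (U := fun _ => ({w}ᶜ : Set E))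
    fun _ => isOpen_compl_singleton.mem_nhds (Ne.symm hw0)
  by_contra! hcon
  have hwN : w ∉ ⋂ n, V n := fun h => hVU 0 (mem_iInter.1 h 0) rfl
  set S : Set E := {s | s ∈ ⋂ n, V n ∧ 0 ≤ s ∧ s ≤ w}
  have hS0 : (0 : E) ∈ S := ⟨mem_iInter.2 hV.zero_mem, le_rfl, hw⟩
  -- For an upper bound `b`, the remainder `w - w ⊓ b` is disjoint from `⋂ n, V n`, hence in the
  -- carrier, hence zero by `hcon`. As `⋂ n, V n` is closed, it then contains `w`, a contradiction.
  have hLUB : IsLUB S w := by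
    refine ⟨fun s hs => hs.2.2, fun b hb => ?_⟩
    have hr0 : 0 ≤ w - w ⊓ b := sub_nonneg.2 inf_le_left
    have hr : w - w ⊓ b = 0 := by
      refine hcon _ ⟨V, hV, fun y hy => ?_⟩ hr0 (sub_le_self w (le_inf hw (hb hS0)))
      rw [abs_of_nonneg hr0]
      have ht0 : 0 ≤ (w - w ⊓ b) ⊓ |y| := le_inf hr0 (abs_nonneg y)
      refine hE.eq_zero_of_add_mem (S := S) ⟨0, hS0⟩ ⟨w, fun s hs => hs.2.2⟩ ht0 fun s hs => ?_
      refine ⟨hV.add_mem_iInter hs.1 (hV.iInter_solid hy ?_), add_nonneg hs.2.1 ht0, ?_⟩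
      · rw [abs_of_nonneg ht0]; exact inf_le_right
      · calc s + (w - w ⊓ b) ⊓ |y| ≤ w ⊓ b + (w - w ⊓ b) :=
              add_le_add (le_inf hs.2.2 (hb hs)) inf_le_left
          _ = w := by abel
    rw [sub_eq_zero] at hr
    exact hr.le.trans inf_le_right
  refine hwN (hV.isClosed_iInter.closure_subset_iff.2 (fun s (hs : s ∈ S) => hs.1)
    (hτ.mem_closure_of_isLUB ⟨0, hS0⟩ (fun s hs t ht => ?_) hLUB))
  refine ⟨hV.iInter_solid (hV.add_mem_iInter hs.1 ht.1) ?_, hs.2.1.trans le_sup_left,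
    sup_le hs.2.2 ht.2.2⟩
  rw [abs_of_nonneg (hs.2.1.trans le_sup_left), abs_of_nonneg (add_nonneg hs.2.1 ht.2.1)]
  exact sup_le (le_add_of_nonneg_right ht.2.1) (le_add_of_nonneg_left hs.2.1)

/-- If an upper bound `b` left a gap `x - x ⊓ b`, a carrier element below the gap could be added to
members of `S` indefinitely. -/
lemma isLUB_carrier (hE : IsArchimedean E) (hτ : IsUOLebesgueTopology E) {x : E} (hx : 0 ≤ x) :
    IsLUB {z | z ∈ carrier E ∧ 0 ≤ z ∧ z ≤ x} x := by
  set S : Set E := {z | z ∈ carrier E ∧ 0 ≤ z ∧ z ≤ x}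
  have hS0 : (0 : E) ∈ S := by
    obtain ⟨W, hW, -⟩ := hτ.exists_isNormalSequence (U := fun _ => univ) fun _ => univ_mem
    refine ⟨⟨W, hW, fun y _ => ?_⟩, le_rfl, hx⟩
    rw [abs_zero]; exact inf_eq_left.2 (abs_nonneg y)
  refine ⟨fun z hz => hz.2.2, fun b hb => ?_⟩
  have hr0 : 0 ≤ x - x ⊓ b := sub_nonneg.2 inf_le_left
  by_cases hr : x - x ⊓ b = 0
  · rw [sub_eq_zero] at hr
    exact hr.le.trans inf_le_right
  obtain ⟨z, hzC, hz0, hzr, hz⟩ := hτ.exists_mem_carrier_le hE hr0 hr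
  refine absurd (hE.eq_zero_of_add_mem (S := S) ⟨0, hS0⟩ ⟨x, fun s hs => hs.2.2⟩ hz0
    fun s hs => ⟨?_, add_nonneg hs.2.1 hz0, ?_⟩) hz
  · obtain ⟨W, hW, hsub⟩ := hτ.exists_subset_disjointComplement (T := {s, z})
      (Set.to_countable _) (insert_subset hs.1 (singleton_subset_iff.2 hzC))
    exact ⟨W, hW, add_mem_disjointComplement hs.2.1 hz0 (hsub (by simp)) (hsub (by simp))⟩
  · calc s + z ≤ x ⊓ b + (x - x ⊓ b) := add_le_add (le_inf hs.2.2 (hb hs)) hzr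
      _ = x := by abel

lemma carrier_eq_univ_of_countableSupProperty (hE : IsArchimedean E)
    (hτ : IsUOLebesgueTopology E) (h : CountableSupProperty E) : carrier E = univ := by
  refine eq_univ_of_forall fun x => ?_
  obtain ⟨T, hTS, hT, hTx⟩ := h _ _ (hτ.isLUB_carrier hE (abs_nonneg x))
  obtain ⟨W, hW, hTW⟩ := hτ.exists_subset_disjointComplement hT fun z hz => (hTS hz).1
  exact ⟨W, hW, mem_disjointComplement_of_abs_le
    (isLUB_mem_disjointComplement hTx (abs_nonneg x) (fun z hz => (hTS hz).2.1) hTW)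
    (abs_abs x).ge⟩

lemma carrier_eq_univ_of_isOrderBasis (hE : IsArchimedean E) (hτ : IsUOLebesgueTopology E)
    {S : Set E} (hS : S.Countable) (hSC : IsOrderBasis (carrier E) S) : carrier E = univ := by
  obtain ⟨W, hW, hSW⟩ := hτ.exists_subset_disjointComplement hS hSC.2.1
  refine carrier_eq_univ_of_iInter_subset hW fun y hy => ?_
  by_contra hy0
  obtain ⟨z, hzC, hz0, hzy, hz⟩ := hτ.exists_mem_carrier_le hE (abs_nonneg y)
    fun h => hy0 (le_antisymm (h ▸ le_abs_self y) (neg_nonpos.1 (h ▸ neg_le_abs y)))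
  have hzN : z ∈ ⋂ n, W n := hW.iInter_solid hy (by rwa [abs_of_nonneg hz0])
  have : z ∈ carrier E ∩ disjointComplement S :=
    ⟨hzC, fun s hs => by rw [inf_comm]; exact hSW hs z hzN⟩
  rw [hSC.2.2] at this
  exact hz this

lemma uoConverges_zero_of_mem (hE : IsArchimedean E) (hτ : IsUOLebesgueTopology E) {x : ℕ → E}
    {V : ℕ → ℕ → Set E} (hV : ∀ k, IsNormalSequence (V k))
    (hx : ∀ k, x k ∈ disjointComplement (⋂ n, V k n)) (hxV : ∀ k n, k < n → x n ∈ V k n) :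
    UOConverges x 0 := by
  have := hτ.isTopologicalAddGroup
  intro y
  refine orderConverges_zero_of_isGLB ?_
  have habs : ∀ n, |(|x n - 0| ⊓ |y|)| = |x n| ⊓ |y| := fun n => by
    rw [sub_zero, abs_of_nonneg (le_inf (abs_nonneg _) (abs_nonneg _))]
  simp only [habs]
  refine ⟨?_, fun w' hw' => ?_⟩
  · rintro z ⟨n, hn⟩
    exact (le_inf (abs_nonneg _) (abs_nonneg _)).trans (hn n le_rfl)
  set w := w' ⊔ 0
  have hw0 : 0 ≤ w := le_sup_right
  have hw : w ∈ lowerBounds {z : E | ∃ n₀ : ℕ, ∀ n, n₀ ≤ n → |x n| ⊓ |y| ≤ z} := fun z hz =>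
    sup_le (hw' hz) (by
      obtain ⟨n, hn⟩ := hz
      exact (le_inf (abs_nonneg _) (abs_nonneg _)).trans (hn n le_rfl))
  -- The sums start at `m + 1 > k`, so they lie in `V k m`; their truncations by `w` increase to
  -- `w`.
  have key : ∀ m k, k ≤ m → w ∈ closure (V k m) := by
    intro m k hkm
    let g : ℕ → E := fun p => w ⊓ ∑ i ∈ Finset.range p, |x (m + 1 + i)|
    have hg : Monotone g := monotone_nat_of_le_succ fun p => by
      refine inf_le_inf_left _ ?_
      rw [Finset.sum_range_succ]
      exact le_add_of_nonneg_right (abs_nonneg _)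
    have hlub : IsLUB (range g) w := by
      refine ⟨?_, fun b hb => ?_⟩
      · rintro _ ⟨p, rfl⟩
        exact inf_le_left
      · refine hE.le_of_inf_abs_le hw (m := m + 1) fun n hn => ?_
        refine le_trans ?_ (hb (mem_range_self (n - m)))
        refine inf_le_inf_left _ ?_
        obtain ⟨i, rfl⟩ := Nat.exists_eq_add_of_le hn
        exact Finset.single_le_sum (f := fun i => |x (m + 1 + i)|) (fun _ _ => abs_nonneg _)
          (Finset.mem_range.2 (by omega))
    refine mem_closure_of_tendsto (hτ.tendsto_of_monotone_nat hg hlub)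
      (Eventually.of_forall fun p => ?_)
    have hsum := (hV k).sum_mem (z := fun n => |x n|) p m fun n hn =>
      (hV k).solid n (hxV k n (by omega)) (abs_abs _).le
    refine (hV k).solid m hsum ?_
    have h0 : 0 ≤ ∑ i ∈ Finset.range p, |x (m + 1 + i)| :=
      Finset.sum_nonneg fun _ _ => abs_nonneg _
    rw [abs_of_nonneg (le_inf hw0 h0), abs_of_nonneg h0]
    exact inf_le_right
  have hN : ∀ k, w ∈ ⋂ n, V k n := fun k => mem_iInter.2 fun n =>
    (hV k).antitone (le_max_left n k)
      ((hV k).closure_subset _ (key (max n k + 1) k (by omega)))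
  have : w ≤ 0 := hE.le_of_inf_abs_le hw (m := 0) fun n _ => by
    have h := hx n w (hN n)
    rw [abs_of_nonneg hw0, inf_comm] at h
    exact h.le
  exact le_sup_left.trans this

theorem exists_isEmbeddedSequence (hE : IsArchimedean E) (hτ : IsUOLebesgueTopology E)
    (hC : carrier E = univ) {A : Type v} [Preorder A] [IsDirectedOrder A] [Nonempty A]
    {x : A → E} {a : E} (hx : Tendsto x atTop (𝓝 a)) :
    ∃ α : ℕ → A, IsEmbeddedSequence α ∧ UOConverges (fun n => x (α n)) a ∧
      Tendsto (fun n => x (α n)) atTop (𝓝 a) := by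
  have := hτ.isTopologicalAddGroup
  have hx0 : Tendsto (fun α => x α - a) atTop (𝓝 0) := tendsto_sub_nhds_zero_iff.2 hx
  choose V hV hVx using fun y : E => (hC ▸ mem_univ y : y ∈ carrier E)
  -- The natural number paired with each index serves as the level of smallness; being strictly
  -- increasing, it is at least `n` at stage `n`.
  obtain ⟨f, -, hf⟩ := exists_seq_of_forall_finset_exists (α := ℕ × A) (fun _ => True)
    (fun p q => p.1 < q.1 ∧ p.2 ≤ q.2 ∧ ((¬ ∃ a : A, IsTop a) → p.2 < q.2) ∧
      x q.2 - a ∈ V (x p.2 - a) q.1) (by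
    intro s _
    obtain ⟨n, hn⟩ := (s.image Prod.fst).exists_le
    have h1 : ∀ᶠ b in atTop, ∀ p ∈ s, p.2 ≤ b ∧ ((¬ ∃ a : A, IsTop a) → p.2 < b) ∧
        x b - a ∈ V (x p.2 - a) (n + 1) := by
      refine (s.eventually_all).2 fun p _ => (eventually_ge_atTop _).and (.and ?_
        (hx0 ((hV _).mem_nhds _)))
      by_cases htop : ∃ a : A, IsTop a
      · exact Eventually.of_forall fun _ h => absurd htop h
      · obtain ⟨c, hc⟩ := exists_gt_of_not_exists_isTop htop p.2
        filter_upwards [eventually_ge_atTop c] with b hb _ using hc.trans_le hb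
    obtain ⟨b, hb⟩ := h1.exists
    exact ⟨(n + 1, b), trivial, fun p hp =>
      ⟨Nat.lt_succ_of_le (hn _ (Finset.mem_image_of_mem _ hp)), hb p hp⟩⟩)
  have hmono : StrictMono fun n => (f n).1 := fun m n h => (hf m n h).1
  have huo : UOConverges (fun n => x (f n).2) a := by
    refine uoConverges_sub_right_iff.1 (hτ.uoConverges_zero_of_mem hE
      (V := fun k => V (x (f k).2 - a)) (fun k => hV _) (fun k => hVx _) fun k n hkn => ?_)
    exact (hV _).antitone (hmono.id_le n) (hf k n hkn).2.2.2
  exact ⟨fun n => (f n).2, ⟨monotone_nat_of_le_succ fun n => (hf n _ n.lt_succ_self).2.1,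
    fun htop => strictMono_nat_of_lt_succ fun n => (hf n _ n.lt_succ_self).2.2.1 htop⟩,
    huo, hτ.tendsto_of_uoConverges_nat huo⟩

theorem countableSupProperty_of_carrier_eq_univ (hE : IsArchimedean E)
    (hτ : IsUOLebesgueTopology E) (hC : carrier E = univ) : CountableSupProperty E := by
  classical
  intro S x hx
  rcases S.eq_empty_or_nonempty with rfl | ⟨s₀, hs₀⟩
  · exact ⟨∅, Subset.rfl, countable_empty, hx⟩
  let A := {t : Finset E // t.Nonempty ∧ ↑t ⊆ S}
  have : Nonempty A := ⟨⟨{s₀}, by simp, by simpa using hs₀⟩⟩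
  have : IsDirectedOrder A := ⟨fun s t => ⟨⟨s.1 ∪ t.1, s.2.1.mono Finset.subset_union_left, by
    rw [Finset.coe_union]; exact union_subset s.2.2 t.2.2⟩,
    (Finset.subset_union_left : s.1 ⊆ s.1 ∪ t.1),
    (Finset.subset_union_right : t.1 ⊆ s.1 ∪ t.1)⟩⟩
  let f : A → E := fun t => t.1.sup' t.2.1 id
  have hf : Monotone f := fun s t h => Finset.sup'_mono id h s.2.1
  have hfx : IsLUB (range f) x := by
    refine ⟨?_, fun b hb => hx.2 fun s hs => ?_⟩
    · rintro _ ⟨t, rfl⟩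
      exact Finset.sup'_le _ _ fun s hs => hx.1 (t.2.2 hs)
    · simpa [f] using hb (mem_range_self (⟨{s}, by simp, by simpa using hs⟩ : A))
  obtain ⟨α, -, huo, -⟩ := hτ.exists_isEmbeddedSequence hE hC (hτ.tendsto_of_monotone hf hfx)
  refine ⟨⋃ n, ↑(α n).1, iUnion_subset fun n => (α n).2.2,
    countable_iUnion fun n => (α n).1.countable_toSet, fun s hs => ?_, fun b hb => ?_⟩
  · obtain ⟨n, hn⟩ := mem_iUnion.1 hs
    exact hx.1 ((α n).2.2 hn)
  · have hr0 : 0 ≤ x - x ⊓ b := sub_nonneg.2 inf_le_left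
    -- Every `f (α n)` stays below `x ⊓ b`, so truncating `|f (α n) - x|` at the gap returns at
    -- least the gap, which every `y β` must dominate.
    obtain ⟨B, _, _, _, y, -, hy0, hy⟩ := huo (x - x ⊓ b)
    have hr : x - x ⊓ b ≤ 0 := hy0.2 (by
      rintro _ ⟨β, rfl⟩
      obtain ⟨n, hn⟩ := hy β
      refine le_trans ?_ (hn n le_rfl)
      have h1 : f (α n) ≤ x ⊓ b := le_inf (hfx.1 (mem_range_self _))
        (Finset.sup'_le _ _ fun s hs => hb (mem_iUnion.2 ⟨n, hs⟩))
      rw [sub_zero]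
      refine le_trans (le_inf ?_ (le_abs_self _)) (le_abs_self _)
      rw [abs_sub_comm]
      exact (sub_le_sub_left h1 x).trans (le_abs_self _))
    exact (sub_nonpos.1 hr).trans inf_le_right

theorem tendsto_iff_exists_subseq_uoConverges (hE : IsArchimedean E)
    (hτ : IsUOLebesgueTopology E) (hC : carrier E = univ) (x : ℕ → E) (a : E) :
    Tendsto x atTop (𝓝 a) ↔ ∀ φ : ℕ → ℕ, StrictMono φ →
      ∃ ψ : ℕ → ℕ, StrictMono ψ ∧ UOConverges (fun n => x (φ (ψ n))) a := by
  refine ⟨fun h φ hφ => ?_, fun h => ?_⟩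
  · obtain ⟨ψ, hψ, huo, -⟩ :=
      hτ.exists_isEmbeddedSequence hE hC (h.comp hφ.tendsto_atTop)
    refine ⟨ψ, hψ.2 ?_, huo⟩
    rintro ⟨n, hn⟩
    exact absurd (hn (n + 1)) (by simp)
  · by_contra hcon
    obtain ⟨U, hU, hfr⟩ := not_tendsto_iff_exists_frequently_notMem.1 hcon
    obtain ⟨φ, hφ, hφU⟩ := extraction_of_frequently_atTop hfr
    obtain ⟨ψ, -, huo⟩ := h φ hφ
    obtain ⟨n, hn⟩ := ((hτ.tendsto_of_uoConverges_nat huo).eventually_mem hU).exists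
    exact hφU _ hn

end IsUOLebesgueTopology

end Topology

end VectorLattice

theorem mainTheorem5 {E : Type*} [AddCommGroup E] [Lattice E] [IsOrderedAddMonoid E]
    [Module ℝ E] [IsOrderedModule ℝ E] [TopologicalSpace E]
    (hE : VectorLattice.IsArchimedean E) (hτ : VectorLattice.IsUOLebesgueTopology E) :
    (VectorLattice.carrier E = univ ↔ VectorLattice.CountableSupProperty E) ∧
    ((∃ S : Set E, S.Countable ∧ VectorLattice.IsOrderBasis (VectorLattice.carrier E) S) →
      VectorLattice.carrier E = univ) ∧
    (TopologicalSpace.MetrizableSpace E → VectorLattice.carrier E = univ) ∧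
    (VectorLattice.carrier E = univ →
      (∀ (A : Type*) [Preorder A] [IsDirectedOrder A] [Nonempty A] (x : A → E) (a : E),
        Tendsto x atTop (𝓝 a) →
          ∃ α : ℕ → A, VectorLattice.IsEmbeddedSequence α ∧
            VectorLattice.UOConverges (fun n => x (α n)) a ∧
            Tendsto (fun n => x (α n)) atTop (𝓝 a)) ∧
      (∀ (x : ℕ → E) (a : E),
        Tendsto x atTop (𝓝 a) ↔
          ∀ φ : ℕ → ℕ, StrictMono φ →
            ∃ ψ : ℕ → ℕ, StrictMono ψ ∧ VectorLattice.UOConverges (fun n => x (φ (ψ n))) a)) :=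
  ⟨⟨hτ.countableSupProperty_of_carrier_eq_univ hE, hτ.carrier_eq_univ_of_countableSupProperty hE⟩,
    fun ⟨_, hS, hSC⟩ => hτ.carrier_eq_univ_of_isOrderBasis hE hS hSC,
    fun _ => hτ.carrier_eq_univ_of_metrizableSpace,
    fun hC => ⟨fun _ _ _ _ _ _ hx => hτ.exists_isEmbeddedSequence hE hC hx,
      hτ.tendsto_iff_exists_subseq_uoConverges hE hC⟩⟩
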